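/- Notation. $M_{d}$ is the algebra of complex $d\times d$ matrices, $M_d^+$ its positive semidefinite elements, and $M_{d_1}\otimes M_{d_2}$ is identified with $M_{d_1}(M_{d_2})$ by $A\otimes B=[a_{ij}B]$. A matrix $X\in (M_{d_1}\otimes M_{d_2})^+$ is separable if $X=\sum_{i=1}^nA_i\otimes B_i$ with $A_i\in M_{d_1}^+$, $B_i\in M_{d_2}^+$. The Schmidt rank $SR(\xi)$ of $\xi\in\mathbb C^{d_1}\otimes\mathbb C^{d_2}$ is the number of non-zero coefficients in a Schmidt decomposition of $\xi$, equivalently the rank of its $d_1\times d_2$ matrix of coordinates. The Schmidt number $SN(X)$ of $X\in (M_{d_1}\otimes M_{d_2})^+$ is the least integer $r\ge 1$ such that $X=\sum_{i=1}^n|\xi_i\rangle\langle\xi_i|$ for some vectors $\xi_i$ with $SR(\xi_i)\le r$ (so $SN(0)=1$). A linear map $\Phi:M_{d_1}\to M_{d_2}$ is positive if $\Phi(M_{d_1}^+)\subseteq M_{d_2}^+$; $k$-positive if $\mathrm{id}_k\otimes\Phi:M_k\otimes M_{d_1}\to M_k\otimes M_{d_2}$ is positive; completely positive (CP) if it is $k$-positive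 for all $k\ge1$; entanglement breaking (EB) if $(\mathrm{id}_k\otimes\Phi)(X)$ is separable for all $k\ge1$ and all $X\in(M_k\otimes M_{d_1})^+$; $k$-entanglement breaking ($k$-EB) if it is $k$-positive and $(\mathrm{id}_k\otimes\Phi)(X)$ is separable for all $X\in(M_k\otimes M_{d_1})^+$. For $V\in M_{d_1\times d_2}$ let $\mathrm{Ad}_V(X)=V^*XV$. A CP-map $\Phi:M_{d_1}\to M_{d_2}$ is $k$-partially entanglement breaking ($k$-PEB) if $\Phi=\sum_{i=1}^n\mathrm{Ad}_{V_i}$ with $\mathrm{rank}(V_i)\le k$ for all $i$. The Choi matrix of $\Phi$ is $C_\Phi=[\Phi(E_{ij})]\in M_{d_1}(M_{d_2})$, where the $E_{ij}$ are the standard matrix units. A projection is a matrix $P$ with $P=P^*=P^2$. Theorem. Let $k>1$ and let $\Phi:M_{d_1}\to M_{d_2}$ be a $k$-positive linear map. The following conditions are equivalent: (i) $\Phi$ is $k$-EB. (ii) $\Phi\circ\Psi$ is EB for all CP-maps $\Psi:M_k\to M_{d_1}$. (iii) $\Phi\circ\Psi$ is EB for all CP-maps $\Psi:M_m\to M_{d_1}$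 and all $1\le m\le k$. (iv) $\Phi\circ\Psi$ is EB for all $k$-PEB maps $\Psi:M_{d_1}\to M_{d_1}$. (v) $\Phi\circ\Psi$ is EB for all $k$-PEB maps $\Psi:M_m\to M_{d_1}$ and all $m\ge1$. (vi) $\Phi\circ\mathrm{Ad}_P$ is EB for all projections $P\in M_{d_1}$ with $\mathrm{rank}(P)=\min\{k,d_1\}$. (vii) For all $m\ge1$ and all $X\in(M_m\otimes M_{d_1})^+$ with $SN(X)\le k$, the matrix $(\mathrm{id}_m\otimes\Phi)(X)$ is positive semidefinite and $SN\big((\mathrm{id}_m\otimes\Phi)(X)\big)=1$. (viii) For all $X\in(M_{d_1}\otimes M_{d_1})^+$ with $SN(X)\le k$, the matrix $(\mathrm{id}_{d_1}\otimes\Phi)(X)$ is positive semidefinite and $SN\big((\mathrm{id}_{d_1}\otimes\Phi)(X)\big)=1$. (ix) $\Gamma\circ\Phi$ is $k$-positive for all positive linear maps $\Gamma:M_{d_2}\to M_m$ and all $m\ge1$. (x) $\Gamma\circ\Phi$ is $k$-positive for all positive linear maps $\Gamma:M_{d_2}\to M_{d_1}$. (xi) $\mathrm{tr}(C_\Phi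 C_{\Gamma\circ\Psi})\ge0$ for all $k$-PEB maps $\Psi:M_{d_1}\to M_{d_1}$ and all positive linear maps $\Gamma:M_{d_1}\to M_{d_2}$. -/

import Mathlib

open scoped ComplexOrder Kronecker

namespace EntBreak

/-- The matrix algebra `M_d` of complex `d × d` matrices. -/
abbrev Mat (d : ℕ) : Type := Matrix (Fin d) (Fin d) ℂ

/-- `M_{d₁} ⊗ M_{d₂}`, identified through the Kronecker product `A ⊗ B = [a_{ij} B]` with the
matrices indexed by `Fin d₁ × Fin d₂`, that is, with `M_{d₁}(M_{d₂})`. -/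
abbrev BiMat (d₁ d₂ : ℕ) : Type := Matrix (Fin d₁ × Fin d₂) (Fin d₁ × Fin d₂) ℂ

/-- `id_m ⊗ Φ`: it applies `Φ` to each of the `m × m` blocks of a matrix in `M_m(M_{d₁})`. -/
def idTensor (m : ℕ) {d₁ d₂ : ℕ} (Φ : Mat d₁ →ₗ[ℂ] Mat d₂) : BiMat m d₁ →ₗ[ℂ] BiMat m d₂ where
  toFun X := Matrix.of fun p q => Φ (Matrix.of fun a b => X (p.1, a) (q.1, b)) p.2 q.2
  map_add' X Y := by
    ext p q
    exact congrFun (congrFun (Φ.map_add (Matrix.of fun a b => X (p.1, a) (q.1, b))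
      (Matrix.of fun a b => Y (p.1, a) (q.1, b))) p.2) q.2
  map_smul' c X := by
    ext p q
    exact congrFun (congrFun (Φ.map_smul c (Matrix.of fun a b => X (p.1, a) (q.1, b))) p.2) q.2

/-- `idTensor` is the tensor product of the identity and `Φ`. -/
theorem idTensor_kronecker (m : ℕ) {d₁ d₂ : ℕ} (Φ : Mat d₁ →ₗ[ℂ] Mat d₂) (A : Mat m) (B : Mat d₁) :
    idTensor m Φ (A ⊗ₖ B) = A ⊗ₖ Φ B := by
  ext p q
  exact congrFun (congrFun (Φ.map_smul (A p.1 q.1) B) p.2) q.2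

/-- Positive linear maps. -/
def IsPositive {d₁ d₂ : ℕ} (Φ : Mat d₁ →ₗ[ℂ] Mat d₂) : Prop :=
  ∀ X : Mat d₁, X.PosSemidef → (Φ X).PosSemidef

/-- `k`-positive linear maps: `id_k ⊗ Φ` is positive. -/
def IsKPositive (k : ℕ) {d₁ d₂ : ℕ} (Φ : Mat d₁ →ₗ[ℂ] Mat d₂) : Prop :=
  ∀ X : BiMat k d₁, X.PosSemidef → (idTensor k Φ X).PosSemidef

/-- Completely positive linear maps. -/
def IsCP {d₁ d₂ : ℕ} (Φ : Mat d₁ →ₗ[ℂ] Mat d₂) : Prop :=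
  ∀ k : ℕ, 1 ≤ k → IsKPositive k Φ

/-- `X = ∑ i, A i ⊗ B i` with positive semidefinite `A i` and `B i`. -/
def IsSeparable {d₁ d₂ : ℕ} (X : BiMat d₁ d₂) : Prop :=
  ∃ (n : ℕ) (A : Fin n → Mat d₁) (B : Fin n → Mat d₂),
    (∀ i, (A i).PosSemidef) ∧ (∀ i, (B i).PosSemidef) ∧ X = ∑ i, A i ⊗ₖ B i

/-- Entanglement breaking linear maps. -/
def IsEB {d₁ d₂ : ℕ} (Φ : Mat d₁ →ₗ[ℂ] Mat d₂) : Prop :=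
  ∀ k : ℕ, 1 ≤ k → ∀ X : BiMat k d₁, X.PosSemidef → IsSeparable (idTensor k Φ X)

/-- `k`-entanglement breaking linear maps. -/
def IsKEB (k : ℕ) {d₁ d₂ : ℕ} (Φ : Mat d₁ →ₗ[ℂ] Mat d₂) : Prop :=
  IsKPositive k Φ ∧ ∀ X : BiMat k d₁, X.PosSemidef → IsSeparable (idTensor k Φ X)

/-- `Ad_V (X) = V* X V`. -/
def Ad {d₁ d₂ : ℕ} (V : Matrix (Fin d₁) (Fin d₂) ℂ) : Mat d₁ →ₗ[ℂ] Mat d₂ where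
  toFun X := V.conjTranspose * X * V
  map_add' X Y := by rw [Matrix.mul_add, Matrix.add_mul]
  map_smul' c X := by rw [Matrix.mul_smul, Matrix.smul_mul, RingHom.id_apply]

/-- `k`-partially entanglement breaking maps: CP-maps that have Choi-Kraus operators of rank
at most `k`. -/
def IsKPEB (k : ℕ) {d₁ d₂ : ℕ} (Φ : Mat d₁ →ₗ[ℂ] Mat d₂) : Prop :=
  IsCP Φ ∧ ∃ (n : ℕ) (V : Fin n → Matrix (Fin d₁) (Fin d₂) ℂ),
    (∀ i, (V i).rank ≤ k) ∧ Φ = ∑ i, Ad (V i)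

/-- The Schmidt rank of `ξ ∈ ℂ^{d₁} ⊗ ℂ^{d₂}`: the rank of its matrix of coordinates. This is the
number of non-zero coefficients in each Schmidt decomposition, see `schmidtRank_eq`. -/
noncomputable def schmidtRank {d₁ d₂ : ℕ} (ξ : Fin d₁ × Fin d₂ → ℂ) : ℕ :=
  (Matrix.of fun a b => ξ (a, b) : Matrix (Fin d₁) (Fin d₂) ℂ).rank

/-- If `ξ = ∑ i, c i • (u i ⊗ v i)` with `r` non-zero coefficients `c i` and with `u` and `v`
orthonormal, then `r` is the Schmidt rank of `ξ`. -/
theorem schmidtRank_eq {d₁ d₂ r : ℕ} (ξ : Fin d₁ × Fin d₂ → ℂ) (c : Fin r → ℝ)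
    (u : Fin r → EuclideanSpace ℂ (Fin d₁)) (v : Fin r → EuclideanSpace ℂ (Fin d₂))
    (hc : ∀ i, c i ≠ 0) (hu : Orthonormal ℂ u) (hv : Orthonormal ℂ v)
    (hξ : ∀ a b, ξ (a, b) = ∑ i, (c i : ℂ) * (u i a * v i b)) : schmidtRank ξ = r := by
  classical
  let U : Matrix (Fin d₁) (Fin r) ℂ := Matrix.of fun a i => u i a
  let W : Matrix (Fin r) (Fin d₂) ℂ := Matrix.of fun i b => v i b
  let D : Matrix (Fin r) (Fin r) ℂ := Matrix.diagonal fun i => (c i : ℂ)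
  have hU : U.conjTranspose * U = 1 := by
    ext i j
    have h := orthonormal_iff_ite.mp hu i j
    rw [PiLp.inner_apply] at h
    simp only [Matrix.mul_apply, Matrix.conjTranspose_apply, Matrix.one_apply, U, Matrix.of_apply]
    rw [← h]
    exact Finset.sum_congr rfl fun a _ => by simp [mul_comm]
  have hW : W * W.conjTranspose = 1 := by
    ext i j
    have h := orthonormal_iff_ite.mp hv j i
    rw [PiLp.inner_apply] at h
    simp only [Matrix.mul_apply, Matrix.conjTranspose_apply, Matrix.one_apply, W, Matrix.of_apply]
    simp only [eq_comm (a := i)]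
    rw [← h]
    exact Finset.sum_congr rfl fun a _ => by simp
  have hM : (Matrix.of fun a b => ξ (a, b) : Matrix (Fin d₁) (Fin d₂) ℂ) = U * D * W := by
    ext a b
    rw [Matrix.of_apply, hξ, Matrix.mul_apply]
    refine Finset.sum_congr rfl fun i _ => ?_
    simp only [D, U, W, Matrix.mul_diagonal, Matrix.of_apply]
    ring
  have hD : D.rank = r := by
    simp [D, Matrix.rank_diagonal, hc]
  have h1 : D = U.conjTranspose * (U * D * W) * W.conjTranspose := by
    calc D = (U.conjTranspose * U) * D * (W * W.conjTranspose) := by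
            rw [hU, hW, Matrix.one_mul, Matrix.mul_one]
      _ = _ := by simp only [Matrix.mul_assoc]
  rw [schmidtRank, hM]
  refine le_antisymm ?_ ?_
  · exact ((Matrix.rank_mul_le_left _ _).trans (Matrix.rank_mul_le_right _ _)).trans hD.le
  · calc r = (U.conjTranspose * (U * D * W) * W.conjTranspose).rank := by rw [← h1, hD]
      _ ≤ (U.conjTranspose * (U * D * W)).rank := Matrix.rank_mul_le_left _ _
      _ ≤ _ := Matrix.rank_mul_le_right _ _

/-- The Schmidt number of a positive semidefinite `X`: the least `r ≥ 1` such that `X` is a finite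
sum of matrices `ξ ξ*` with vectors `ξ` of Schmidt rank at most `r`. The zero matrix is separable
and has Schmidt number `1`. -/
noncomputable def schmidtNumber {d₁ d₂ : ℕ} (X : BiMat d₁ d₂) : ℕ :=
  sInf {r : ℕ | 1 ≤ r ∧ ∃ (n : ℕ) (ξ : Fin n → Fin d₁ × Fin d₂ → ℂ),
    (∀ i, schmidtRank (ξ i) ≤ r) ∧ X = ∑ i, Matrix.vecMulVec (ξ i) (star (ξ i))}

/-- The Choi matrix `C_Φ = [Φ (E_{ij})] ∈ M_{d₁}(M_{d₂})`. -/
def choi {d₁ d₂ : ℕ} (Φ : Mat d₁ →ₗ[ℂ] Mat d₂) : BiMat d₁ d₂ :=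
  Matrix.of fun p q => Φ (Matrix.single p.1 q.1 1) p.2 q.2

end EntBreak

namespace EntBreak

open Matrix

/-! The Choi correspondence turns statements about maps into statements about matrices: `choi (Φ ∘ₗ
Ψ)` is `id ⊗ Φ` applied to `choi Ψ`, complete positivity becomes positive semidefiniteness,
entanglement breaking becomes separability (`isEB_iff`), and `Ad V` becomes a rank one matrix `ξ ξ*`
with `SR(ξ) = rank V`.

Hence every condition without an auxiliary positive map says that `Φ ∘ₗ Ad V` is EB for all `V` of
rank at most `k`. Such a `V` factors through `ℂ^k`, which reduces it to maps from `M_k`; it also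
satisfies `V = V P` for a projection `P` of rank `min k d₁`, which reduces it to projections. Both
reductions use that EB survives precomposition with `Ad`.

The conditions with a positive map `Γ` are dual to these. Separable matrices form a cone over a
compact convex set, so Hahn-Banach detects separability of a positive semidefinite matrix by
block-positive matrices (`isSeparable_of_forall_trace`), which are exactly the Choi matrices of
positive maps. Here `k`-positivity of `Φ` makes `choi (Φ ∘ₗ Ad P)` positive semidefinite
(`IsKPositive.isCP_comp_Ad`). -/

theorem schmidtRank_star {m d : ℕ} (V : Matrix (Fin m) (Fin d) ℂ) :
    schmidtRank (fun p => star (V p.1 p.2)) = V.rank := by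
  have : (Matrix.of fun a b => star (V a b) : Matrix (Fin m) (Fin d) ℂ) = Vᴴᵀ := by
    ext; simp
  rw [schmidtRank]
  exact (congrArg Matrix.rank this).trans (by rw [rank_transpose, rank_conjTranspose])

/-! ### Choi matrices and Kraus decompositions -/

theorem idTensor_comp (m : ℕ) {a b c : ℕ} (Φ : Mat b →ₗ[ℂ] Mat c) (Ψ : Mat a →ₗ[ℂ] Mat b) :
    idTensor m (Φ ∘ₗ Ψ) = idTensor m Φ ∘ₗ idTensor m Ψ := rfl

theorem choi_comp {a b c : ℕ} (Φ : Mat b →ₗ[ℂ] Mat c) (Ψ : Mat a →ₗ[ℂ] Mat b) :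
    choi (Φ ∘ₗ Ψ) = idTensor a Φ (choi Ψ) := rfl

theorem idTensor_sum (m : ℕ) {a b : ℕ} {ι : Type*} (s : Finset ι) (Φ : ι → Mat a →ₗ[ℂ] Mat b)
    (X : BiMat m a) : idTensor m (∑ i ∈ s, Φ i) X = ∑ i ∈ s, idTensor m (Φ i) X := by
  ext p q
  simp [idTensor, Matrix.sum_apply]

theorem choi_sum {a b : ℕ} {ι : Type*} (s : Finset ι) (Φ : ι → Mat a →ₗ[ℂ] Mat b) :
    choi (∑ i ∈ s, Φ i) = ∑ i ∈ s, choi (Φ i) := by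
  ext p q
  simp [choi, Matrix.sum_apply]

theorem choi_injective {a b : ℕ} :
    Function.Injective (choi : (Mat a →ₗ[ℂ] Mat b) → BiMat a b) := by
  intro Φ Ψ h
  refine Matrix.ext_linearMap _ fun i j => LinearMap.ext_ring ?_
  ext c d
  exact congrFun (congrFun h (i, c)) (j, d)

/-- The conjugate comes from the left factor of `V* E_{ij} V`, whose `(c, d)` entry is `star (V i c)
* V j d`. -/
theorem choi_Ad {m d : ℕ} (V : Matrix (Fin m) (Fin d) ℂ) :
    choi (Ad V) = vecMulVec (fun p => star (V p.1 p.2)) (star fun p => star (V p.1 p.2)) := by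
  ext p q
  simp [choi, Ad, vecMulVec_apply, Matrix.mul_apply, Matrix.single_apply, ite_and]

theorem idTensor_Ad (m : ℕ) {a b : ℕ} (V : Matrix (Fin a) (Fin b) ℂ) (X : BiMat m a) :
    idTensor m (Ad V) X = ((1 : Mat m) ⊗ₖ V)ᴴ * X * ((1 : Mat m) ⊗ₖ V) := by
  ext p q
  simp [idTensor, Ad, Matrix.mul_apply, apply_ite (starRingEnd ℂ), Fintype.sum_prod_type, Matrix.one_apply, Finset.sum_mul]

theorem Ad_mul {a b c : ℕ} (V : Matrix (Fin a) (Fin b) ℂ) (W : Matrix (Fin b) (Fin c) ℂ) :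
    Ad (V * W) = Ad W ∘ₗ Ad V := by
  ext1 X
  simp [Ad, Matrix.mul_assoc]

theorem isCP_Ad {a b : ℕ} (V : Matrix (Fin a) (Fin b) ℂ) : IsCP (Ad V) := by
  intro k _ X hX
  rw [idTensor_Ad]
  exact hX.conjTranspose_mul_mul_same _

theorem isCP_sum {a b : ℕ} {ι : Type*} (s : Finset ι) (Φ : ι → Mat a →ₗ[ℂ] Mat b)
    (h : ∀ i ∈ s, IsCP (Φ i)) : IsCP (∑ i ∈ s, Φ i) := by
  intro k hk X hX
  rw [idTensor_sum]
  exact posSemidef_sum _ fun i hi => h i hi k hk X hX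

theorem Ad_one {a : ℕ} : Ad (1 : Mat a) = LinearMap.id := by
  ext1 X
  simp [Ad]

/-- Choi's theorem: the Choi matrix of a completely positive map is positive semidefinite. -/
theorem IsCP.choi_posSemidef {a b : ℕ} {Φ : Mat a →ₗ[ℂ] Mat b} (h : IsCP Φ) :
    (choi Φ).PosSemidef := by
  -- Complete positivity only tests sizes `k ≥ 1`, so `a = 0` is separate.
  rcases Nat.eq_zero_or_pos a with rfl | ha
  · rw [Subsingleton.elim (choi Φ) 0]
    exact .zero
  -- The test matrix `choi (Ad 1)` is the unnormalised maximally entangled state; `id ⊗ Φ` sends it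
  -- to `choi Φ`.
  · have := h a ha (choi (Ad 1)) (by rw [choi_Ad]; exact posSemidef_vecMulVec_self_star _)
    rwa [← choi_comp, Ad_one, LinearMap.comp_id] at this

/-- Every rank one matrix `ξ ξ*` is the Choi matrix of some `Ad V`. -/
theorem exists_choi_Ad_eq {m d : ℕ} (ξ : Fin m × Fin d → ℂ) :
    ∃ V : Matrix (Fin m) (Fin d) ℂ, V.rank = schmidtRank ξ ∧
      choi (Ad V) = vecMulVec ξ (star ξ) := by
  have h : (fun p : Fin m × Fin d => star ((Matrix.of fun a b => star (ξ (a, b))) p.1 p.2)) = ξ := by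
    ext p; simp
  refine ⟨Matrix.of fun a b => star (ξ (a, b)), ?_, ?_⟩
  · rw [← schmidtRank_star, h]
  · rw [choi_Ad, h]

theorem posSemidef_eq_sum_choi_Ad {m d : ℕ} {X : BiMat m d} (hX : X.PosSemidef) :
    ∃ (n : ℕ) (V : Fin n → Matrix (Fin m) (Fin d) ℂ), X = ∑ i, choi (Ad (V i)) := by
  obtain ⟨n, ξ, rfl⟩ := posSemidef_iff_eq_sum_vecMulVec.mp hX
  choose V _ hV using fun i => exists_choi_Ad_eq (ξ i)
  exact ⟨n, V, by simp [hV]⟩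

/-- Kraus decomposition. -/
theorem exists_eq_sum_Ad {a b : ℕ} {Φ : Mat a →ₗ[ℂ] Mat b} (h : (choi Φ).PosSemidef) :
    ∃ (n : ℕ) (V : Fin n → Matrix (Fin a) (Fin b) ℂ), Φ = ∑ i, Ad (V i) := by
  obtain ⟨n, V, hV⟩ := posSemidef_eq_sum_choi_Ad h
  exact ⟨n, V, choi_injective (hV.trans (choi_sum _ _).symm)⟩

theorem isCP_of_choi_posSemidef {a b : ℕ} {Φ : Mat a →ₗ[ℂ] Mat b} (h : (choi Φ).PosSemidef) :
    IsCP Φ := by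
  obtain ⟨n, V, rfl⟩ := exists_eq_sum_Ad h
  exact isCP_sum _ _ fun i _ => isCP_Ad _

theorem exists_choi_eq {a b : ℕ} (X : BiMat a b) : ∃ Φ : Mat a →ₗ[ℂ] Mat b, choi Φ = X := by
  refine ⟨
    { toFun := fun Y => Matrix.of fun c d => ∑ i, ∑ j, Y i j * X (i, c) (j, d)
      map_add' := fun Y Z => by
        ext; simp [add_mul, Finset.sum_add_distrib]
      map_smul' := fun r Y => by
        ext; simp [mul_assoc, Finset.mul_sum] }, ?_⟩
  ext p q
  simp [choi, Matrix.single_apply, ite_and]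

/-! ### Separable matrices -/

theorem IsSeparable.zero {a b : ℕ} : IsSeparable (0 : BiMat a b) :=
  ⟨0, Fin.elim0, Fin.elim0, fun i => i.elim0, fun i => i.elim0, by simp⟩

theorem isSeparable_kronecker {a b : ℕ} {A : Mat a} {B : Mat b} (hA : A.PosSemidef)
    (hB : B.PosSemidef) : IsSeparable (A ⊗ₖ B) :=
  ⟨1, fun _ => A, fun _ => B, fun _ => hA, fun _ => hB, by simp⟩

theorem IsSeparable.add {a b : ℕ} {X Y : BiMat a b} (hX : IsSeparable X) (hY : IsSeparable Y) :
    IsSeparable (X + Y) := by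
  obtain ⟨n, A, B, hA, hB, rfl⟩ := hX
  obtain ⟨m, A', B', hA', hB', rfl⟩ := hY
  refine ⟨n + m, Fin.append A A', Fin.append B B', fun i => ?_, fun i => ?_, ?_⟩
  · refine Fin.addCases (fun j => ?_) (fun j => ?_) i <;> simp [hA, hA']
  · refine Fin.addCases (fun j => ?_) (fun j => ?_) i <;> simp [hB, hB']
  · simp [Fin.sum_univ_add]

theorem isSeparable_sum {a b : ℕ} {ι : Type*} (s : Finset ι) {X : ι → BiMat a b}
    (h : ∀ i ∈ s, IsSeparable (X i)) : IsSeparable (∑ i ∈ s, X i) :=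
  Finset.sum_induction _ _ (fun _ _ => IsSeparable.add) .zero h

theorem IsSeparable.smul {a b : ℕ} {X : BiMat a b} (hX : IsSeparable X) {r : ℝ} (hr : 0 ≤ r) :
    IsSeparable (r • X) := by
  obtain ⟨n, A, B, hA, hB, rfl⟩ := hX
  exact ⟨n, fun i => r • A i, B, fun i => (hA i).smul hr, hB, by
    simp [Finset.smul_sum, smul_kronecker]⟩

theorem IsSeparable.posSemidef {a b : ℕ} {X : BiMat a b} (hX : IsSeparable X) :
    X.PosSemidef := by
  obtain ⟨n, A, B, hA, hB, rfl⟩ := hX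
  exact posSemidef_sum _ fun i _ => (hA i).kronecker (hB i)

theorem vecMulVec_kronecker_vecMulVec {a b : ℕ} (x : Fin a → ℂ) (y : Fin b → ℂ) :
    vecMulVec x (star x) ⊗ₖ vecMulVec y (star y) =
      vecMulVec (fun p : Fin a × Fin b => x p.1 * y p.2) (star fun p => x p.1 * y p.2) := by
  ext p q
  simp [vecMulVec_apply]
  ring

theorem IsSeparable.exists_rank_one {a b : ℕ} {X : BiMat a b} (hX : IsSeparable X) :
    ∃ (n : ℕ) (x : Fin n → Fin a → ℂ) (y : Fin n → Fin b → ℂ),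
      X = ∑ i, vecMulVec (x i) (star (x i)) ⊗ₖ vecMulVec (y i) (star (y i)) := by
  obtain ⟨n, A, B, hA, hB, rfl⟩ := hX
  choose p x hx using fun i => posSemidef_iff_eq_sum_vecMulVec.mp (hA i)
  choose q y hy using fun i => posSemidef_iff_eq_sum_vecMulVec.mp (hB i)
  let e := Fintype.equivFin (Σ i : Fin n, Fin (p i) × Fin (q i))
  refine ⟨_, fun t => x (e.symm t).1 (e.symm t).2.1, fun t => y (e.symm t).1 (e.symm t).2.2, ?_⟩
  rw [e.symm.sum_comp (fun s => vecMulVec (x s.1 s.2.1) (star (x s.1 s.2.1)) ⊗ₖ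
    vecMulVec (y s.1 s.2.2) (star (y s.1 s.2.2))), Fintype.sum_sigma]
  refine Finset.sum_congr rfl fun i _ => ?_
  rw [hx, hy, Fintype.sum_prod_type]
  ext s t
  simp [Matrix.sum_apply, Finset.sum_mul_sum]

theorem schmidtRank_mul_le {a b : ℕ} (x : Fin a → ℂ) (y : Fin b → ℂ) :
    schmidtRank (fun p : Fin a × Fin b => x p.1 * y p.2) ≤ 1 :=
  rank_vecMulVec_le x y

/-- Rank factorization. -/
theorem exists_eq_mul_of_rank_le {a b k : ℕ} {V : Matrix (Fin a) (Fin b) ℂ} (h : V.rank ≤ k) :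
    ∃ (A : Matrix (Fin a) (Fin k) ℂ) (B : Matrix (Fin k) (Fin b) ℂ), V = A * B := by
  have h' : Module.finrank ℂ (LinearMap.range V.mulVecLin) ≤ Module.finrank ℂ (Fin k → ℂ) := by
    rw [Module.finrank_fin_fun]
    exact h
  -- The range of `V` embeds in `ℂ^k` by `f`, with left inverse `g`. Then `B` is `V` followed by
  -- `f`, and `A` is `g` followed by the inclusion.
  obtain ⟨f, hf⟩ := finrank_le_iff_exists_linearMap.mp h'
  obtain ⟨g, hg⟩ := f.exists_leftInverse_of_injective (LinearMap.ker_eq_bot.mpr hf)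
  refine ⟨LinearMap.toMatrix' (Submodule.subtype _ ∘ₗ g),
    LinearMap.toMatrix' (f ∘ₗ V.mulVecLin.rangeRestrict), ?_⟩
  have hc : (Submodule.subtype _ ∘ₗ g) ∘ₗ (f ∘ₗ V.mulVecLin.rangeRestrict) = V.mulVecLin := by
    ext1 x
    have := LinearMap.congr_fun hg (V.mulVecLin.rangeRestrict (LinearMap.single ℂ (fun _ => ℂ) x 1))
    ext1
    simpa using congrArg Subtype.val this
  rw [← LinearMap.toMatrix'_comp, hc, ← Matrix.toLin'_apply', LinearMap.toMatrix'_toLin']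

theorem exists_eq_vecMulVec_of_rank_le_one {a b : ℕ} {V : Matrix (Fin a) (Fin b) ℂ}
    (h : V.rank ≤ 1) : ∃ x y, V = vecMulVec x y := by
  obtain ⟨A, B, rfl⟩ := exists_eq_mul_of_rank_le h
  refine ⟨fun i => A i 0, fun j => B 0 j, ?_⟩
  ext i j
  simp [Matrix.mul_apply, vecMulVec_apply]

theorem isSeparable_iff_vecMulVec {a b : ℕ} {X : BiMat a b} :
    IsSeparable X ↔ ∃ (n : ℕ) (ξ : Fin n → Fin a × Fin b → ℂ),
      (∀ i, schmidtRank (ξ i) ≤ 1) ∧ X = ∑ i, vecMulVec (ξ i) (star (ξ i)) := by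
  constructor
  · intro h
    obtain ⟨n, x, y, rfl⟩ := h.exists_rank_one
    exact ⟨n, fun i p => x i p.1 * y i p.2, fun i => schmidtRank_mul_le _ _, by
      simp only [vecMulVec_kronecker_vecMulVec]⟩
  · rintro ⟨n, ξ, hξ, rfl⟩
    refine isSeparable_sum _ fun i _ => ?_
    obtain ⟨x, y, h⟩ := exists_eq_vecMulVec_of_rank_le_one (hξ i)
    have : ξ i = fun p => x p.1 * y p.2 := by
      ext p
      exact congrFun (congrFun h p.1) p.2
    rw [this, ← vecMulVec_kronecker_vecMulVec]
    exact isSeparable_kronecker (posSemidef_vecMulVec_self_star _)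
      (posSemidef_vecMulVec_self_star _)

/-- A map with a separable Choi matrix is entanglement breaking. -/
theorem isSeparable_idTensor_of_choi {a b k : ℕ} {Φ : Mat a →ₗ[ℂ] Mat b}
    (h : IsSeparable (choi Φ)) {X : BiMat k a} (hX : X.PosSemidef) :
    IsSeparable (idTensor k Φ X) := by
  obtain ⟨n, x, y, h⟩ := h.exists_rank_one
  have hΦ : Φ = ∑ i, Ad (vecMulVec (star (x i)) (star (y i))) := by
    apply choi_injective
    rw [choi_sum, h]
    refine Finset.sum_congr rfl fun i _ => ?_
    rw [choi_Ad, vecMulVec_kronecker_vecMulVec]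
    simp [vecMulVec_apply]
  rw [hΦ, idTensor_sum]
  refine isSeparable_sum _ fun i _ => ?_
  -- Each Kraus term measures and prepares: `Y ↦ (xᵀ Y x̄) y y*`. So `id ⊗ Ad` gives `q ⊗ y y*`,
  -- where `q` is the compression of `X` by `1 ⊗ x̄`.
  have hq := (hX.conjTranspose_mul_mul_same
    ((1 : Mat k) ⊗ₖ replicateCol Unit (star (x i)))).submatrix (fun r : Fin k => (r, ()))
  convert isSeparable_kronecker hq (posSemidef_vecMulVec_self_star (y i)) using 1
  ext p q
  simp [idTensor, Ad, Matrix.mul_apply, apply_ite (starRingEnd ℂ), Fintype.sum_prod_type, Matrix.one_apply, Finset.sum_mul,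
    vecMulVec_apply]
  refine Finset.sum_congr rfl fun c _ => Finset.sum_congr rfl fun d _ => ?_
  ring

/-- The maximally entangled matrix `choi (Ad 1)` is a sufficient test: its image is `choi Φ`, and a
separable Choi matrix gives rank one Kraus operators. -/
theorem isEB_iff {a b : ℕ} {Φ : Mat a →ₗ[ℂ] Mat b} : IsEB Φ ↔ IsSeparable (choi Φ) := by
  refine ⟨fun h => ?_, fun h k _ X hX => isSeparable_idTensor_of_choi h hX⟩
  rcases Nat.eq_zero_or_pos a with rfl | ha
  · rw [Subsingleton.elim (choi Φ) 0]
    exact .zero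
  · have := h a ha (choi (Ad 1)) (by rw [choi_Ad]; exact posSemidef_vecMulVec_self_star _)
    rwa [← choi_comp, Ad_one, LinearMap.comp_id] at this

theorem IsEB.comp_Ad {a b c : ℕ} {Φ : Mat b →ₗ[ℂ] Mat c} (h : IsEB Φ)
    (V : Matrix (Fin a) (Fin b) ℂ) : IsEB (Φ ∘ₗ Ad V) := fun k hk X hX => by
  rw [idTensor_comp]
  exact h k hk _ (isCP_Ad V k hk X hX)

theorem isEB_comp_sum_Ad {a b c n : ℕ} {Φ : Mat b →ₗ[ℂ] Mat c}
    {V : Fin n → Matrix (Fin a) (Fin b) ℂ} (h : ∀ i, IsEB (Φ ∘ₗ Ad (V i))) :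
    IsEB (Φ ∘ₗ ∑ i, Ad (V i)) := by
  have : Φ ∘ₗ ∑ i, Ad (V i) = ∑ i, Φ ∘ₗ Ad (V i) := by
    ext1 X
    simp
  rw [this, isEB_iff, choi_sum]
  exact isSeparable_sum _ fun i _ => isEB_iff.mp (h i)

/-! ### Schmidt numbers -/

theorem schmidtNumber_le {a b r : ℕ} (hr : 1 ≤ r) {X : BiMat a b} {n : ℕ}
    {ξ : Fin n → Fin a × Fin b → ℂ} (hξ : ∀ i, schmidtRank (ξ i) ≤ r)
    (hX : X = ∑ i, vecMulVec (ξ i) (star (ξ i))) : schmidtNumber X ≤ r :=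
  Nat.sInf_le ⟨hr, n, ξ, hξ, hX⟩

theorem schmidtNumber_choi_Ad_le {a b r : ℕ} (hr : 1 ≤ r) {V : Matrix (Fin a) (Fin b) ℂ}
    (hV : V.rank ≤ r) : schmidtNumber (choi (Ad V)) ≤ r :=
  schmidtNumber_le hr (n := 1) (ξ := fun _ p => star (V p.1 p.2))
    (fun _ => (schmidtRank_star V).trans_le hV) (by simp [choi_Ad])

theorem exists_sum_choi_Ad_of_schmidtNumber_le {a b r : ℕ} {X : BiMat a b} (hX : X.PosSemidef)
    (h : schmidtNumber X ≤ r) : ∃ (n : ℕ) (V : Fin n → Matrix (Fin a) (Fin b) ℂ),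
      (∀ i, (V i).rank ≤ r) ∧ X = ∑ i, choi (Ad (V i)) := by
  have hne : {r : ℕ | 1 ≤ r ∧ ∃ (n : ℕ) (ξ : Fin n → Fin a × Fin b → ℂ),
      (∀ i, schmidtRank (ξ i) ≤ r) ∧ X = ∑ i, vecMulVec (ξ i) (star (ξ i))}.Nonempty := by
    obtain ⟨n, ξ, hξ⟩ := posSemidef_iff_eq_sum_vecMulVec.mp hX
    -- `a + 1` rather than `a` keeps the bound at least `1` when `a = 0`.
    exact ⟨a + 1, by simp, n, ξ, fun i => (rank_le_height _).trans (Nat.le_succ a), hξ⟩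
  obtain ⟨-, n, ξ, hξ, hX'⟩ := Nat.sInf_mem hne
  choose V hr hV using fun i => exists_choi_Ad_eq (ξ i)
  exact ⟨n, V, fun i => (hr i).trans_le ((hξ i).trans h), by simp [hV, hX']⟩

theorem schmidtNumber_eq_one_iff {a b : ℕ} {X : BiMat a b} :
    schmidtNumber X = 1 ↔ IsSeparable X := by
  rw [isSeparable_iff_vecMulVec]
  constructor
  · intro h
    -- The value `1` rules out the default `sInf ∅ = 0`.
    have := Nat.sInf_mem (Nat.nonempty_of_sInf_eq_succ h)
    rw [← schmidtNumber, h] at this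
    exact this.2
  · rintro ⟨n, ξ, hξ, hX⟩
    refine le_antisymm (schmidtNumber_le le_rfl hξ hX) ?_
    exact (Nat.sInf_mem (s := {r : ℕ | 1 ≤ r ∧ ∃ (n : ℕ) (ξ : Fin n → Fin a × Fin b → ℂ),
      (∀ i, schmidtRank (ξ i) ≤ r) ∧ X = ∑ i, vecMulVec (ξ i) (star (ξ i))})
      ⟨1, le_rfl, n, ξ, hξ, hX⟩).1

/-! ### Separation from the separable cone -/

/-- In finite dimension, the convex hull of a compact set is compact. -/
theorem isCompact_convexHull_of_isCompact {E : Type*} [AddCommGroup E] [Module ℝ E]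
    [TopologicalSpace E] [IsTopologicalAddGroup E] [ContinuousSMul ℝ E] [FiniteDimensional ℝ E]
    {s : Set E} (hs : IsCompact s) : IsCompact (convexHull ℝ s) := by
  rcases s.eq_empty_or_nonempty with rfl | ⟨x₀, hx₀⟩
  · simp
  let N := Module.finrank ℝ E + 1
  let F : (Fin N → ℝ) × (Fin N → E) → E := fun p => ∑ i, p.1 i • p.2 i
  have hF : Continuous F := by fun_prop
  have hK : IsCompact (stdSimplex ℝ (Fin N) ×ˢ Set.univ.pi fun _ : Fin N => s) :=
    (isCompact_stdSimplex ℝ _).prod (isCompact_univ_pi fun _ => hs)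
  convert hK.image hF using 1
  refine Set.Subset.antisymm (fun x hx => ?_) ?_
  -- Carathéodory: affinely independent points number at most `N`. The family is padded to length
  -- `N` by copies of `x₀` with weight `0`.
  · obtain ⟨ι, _, z, w, hz, hi, hw, hw1, rfl⟩ := eq_pos_convex_span_of_mem_convexHull hx
    have hcard : Fintype.card ι ≤ Fintype.card (Fin N) := by
      rw [Fintype.card_fin]
      exact hi.card_le_finrank_succ.trans (Nat.succ_le_succ (Submodule.finrank_le _))
    obtain ⟨e⟩ := Function.Embedding.nonempty_of_card_le hcard
    have hw0 : ∀ j, j ∉ Set.range e → Function.extend e w 0 j = 0 := fun j hj =>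
      Function.extend_apply' _ _ _ hj
    refine ⟨(Function.extend e w 0, Function.extend e z fun _ => x₀), ⟨⟨fun j => ?_, ?_⟩, ?_⟩, ?_⟩
    · change 0 ≤ Function.extend e w 0 j
      by_cases h : j ∈ Set.range e
      · obtain ⟨i, rfl⟩ := h
        rw [e.injective.extend_apply]
        exact (hw i).le
      · rw [hw0 j h]
    · rw [← hw1]
      exact (Fintype.sum_of_injective e e.injective w _ hw0
        fun i => (e.injective.extend_apply w 0 i).symm).symm
    · intro j _
      by_cases h : ∃ i, e i = j
      · obtain ⟨i, rfl⟩ := h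
        simpa [e.injective.extend_apply] using hz ⟨i, rfl⟩
      · simpa [Function.extend_apply' _ _ _ h] using hx₀
    · exact (Fintype.sum_of_injective e e.injective _ _ (fun j hj => by simp [hw0 j hj])
        fun i => by simp [e.injective.extend_apply]).symm
  · rintro _ ⟨⟨w, z⟩, ⟨⟨hw, hw1⟩, hz⟩, rfl⟩
    exact (convex_convexHull ℝ s).sum_mem (fun i _ => hw i) hw1
      fun i _ => subset_convexHull ℝ s (hz i trivial)

/-- The pure product states. -/
def pureProducts (a b : ℕ) : Set (Fin a × Fin b → Fin a × Fin b → ℂ) :=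
  (fun p : EuclideanSpace ℂ (Fin a) × EuclideanSpace ℂ (Fin b) =>
      of.symm (vecMulVec p.1.ofLp (star p.1.ofLp) ⊗ₖ vecMulVec p.2.ofLp (star p.2.ofLp))) ''
    Metric.sphere 0 1 ×ˢ Metric.sphere 0 1

theorem isCompact_pureProducts (a b : ℕ) : IsCompact (pureProducts a b) := by
  refine ((isCompact_sphere _ _).prod (isCompact_sphere _ _)).image ?_
  refine continuous_pi fun p => continuous_pi fun q => ?_
  simp only [of_symm_apply, kroneckerMap_apply, vecMulVec_apply, Pi.star_apply]
  fun_prop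

theorem trace_vecMulVec_star {a : ℕ} (x : EuclideanSpace ℂ (Fin a)) :
    (vecMulVec x.ofLp (star x.ofLp)).trace = ((‖x‖ ^ 2 : ℝ) : ℂ) := by
  rw [EuclideanSpace.norm_sq_eq]
  simp [Matrix.trace, vecMulVec_apply, Complex.mul_conj, Complex.normSq_eq_norm_sq]

theorem isSeparable_of_mem_convexHull {a b : ℕ} {Z : Fin a × Fin b → Fin a × Fin b → ℂ}
    (hZ : Z ∈ convexHull ℝ (pureProducts a b)) : IsSeparable (of Z) := by
  have hc : Convex ℝ {Z : Fin a × Fin b → Fin a × Fin b → ℂ | IsSeparable (of Z)} := by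
    intro X hX Y hY r s hr hs _
    exact (hX.smul hr).add (hY.smul hs)
  refine convexHull_min ?_ hc hZ
  rintro _ ⟨p, -, rfl⟩
  exact isSeparable_kronecker (posSemidef_vecMulVec_self_star _)
    (posSemidef_vecMulVec_self_star _)

/-- After scaling to trace one, `Z` lies outside the compact convex hull of the pure products, so
some `f` is below `u` at `Z` and above `u` on the hull. Subtracting `u` times the trace makes the
inequality homogeneous, with threshold `0`. -/
theorem exists_functional_of_not_isSeparable {a b : ℕ} {Z : BiMat a b} (hZ : Z.PosSemidef)
    (h : ¬ IsSeparable Z) : ∃ H : BiMat a b, (H * Z).trace.re < 0 ∧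
      ∀ x y, 0 ≤ (H * (vecMulVec x (star x) ⊗ₖ vecMulVec y (star y))).trace.re := by
  have hZ0 : Z ≠ 0 := fun h0 => h (h0 ▸ .zero)
  have htr : 0 < Z.trace :=
    lt_of_le_of_ne hZ.trace_nonneg fun h0 => hZ0 (hZ.trace_eq_zero_iff.mp h0.symm)
  obtain ⟨t, ht, htZ⟩ : ∃ t : ℝ, 0 < t ∧ Z.trace = t :=
    ⟨Z.trace.re, (Complex.pos_iff.mp htr).1, Complex.ext rfl (Complex.pos_iff.mp htr).2.symm⟩
  have hnot : of.symm (t⁻¹ • Z) ∉ convexHull ℝ (pureProducts a b) := by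
    intro hm
    have := (isSeparable_of_mem_convexHull hm).smul ht.le
    rw [Equiv.apply_symm_apply, smul_smul, mul_inv_cancel₀ ht.ne', one_smul] at this
    exact h this
  obtain ⟨f, u, hfu, hf⟩ := RCLike.geometric_hahn_banach_point_closed (𝕜 := ℂ)
    (convex_convexHull ℝ (pureProducts a b))
    (isCompact_convexHull_of_isCompact (isCompact_pureProducts a b)).isClosed hnot
  let G : BiMat a b := of fun p q => f (of.symm (Matrix.single q p 1))
  have hG : ∀ X : BiMat a b, (G * X).trace = f (of.symm X) := by
    intro X
    have : of.symm X = ∑ p, ∑ q, X p q • of.symm (Matrix.single p q (1 : ℂ)) := by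
      ext i j
      simp [Finset.sum_apply, Pi.single_apply, ite_apply]
    rw [this]
    simp only [map_sum, map_smul, smul_eq_mul, Matrix.trace, Matrix.diag_apply, Matrix.mul_apply, G,
      of_apply]
    rw [Finset.sum_comm]
    exact Finset.sum_congr rfl fun _ _ => Finset.sum_congr rfl fun _ _ => mul_comm _ _
  have hH : ∀ X : BiMat a b, ((G - (u : ℂ) • 1) * X).trace = f (of.symm X) - u * X.trace := by
    intro X
    rw [Matrix.sub_mul, Matrix.trace_sub, hG, Matrix.smul_mul, Matrix.one_mul, Matrix.trace_smul,
      smul_eq_mul]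
  refine ⟨G - (u : ℂ) • 1, ?_, fun x y => ?_⟩
  · have hs : of.symm (t⁻¹ • Z) = ((t⁻¹ : ℝ) : ℂ) • of.symm Z := by
      ext i j
      simp
    rw [hs, map_smul, smul_eq_mul] at hfu
    rw [hH, htZ]
    simp only [RCLike.re_eq_complex_re, Complex.re_ofReal_mul] at hfu
    have := mul_lt_mul_of_pos_left hfu ht
    rw [← mul_assoc, mul_inv_cancel₀ ht.ne', one_mul] at this
    simp only [Complex.sub_re, Complex.mul_re, Complex.ofReal_re, Complex.ofReal_im]
    linarith
  · by_cases hx : x = 0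
    · simp [hx]
    by_cases hy : y = 0
    · simp [hy]
    have hx' : ‖WithLp.toLp 2 x‖ ≠ 0 := by simpa using hx
    have hy' : ‖WithLp.toLp 2 y‖ ≠ 0 := by simpa using hy
    set r := ‖WithLp.toLp 2 x‖
    set s := ‖WithLp.toLp 2 y‖
    let x' : EuclideanSpace ℂ (Fin a) := ((r⁻¹ : ℝ) : ℂ) • WithLp.toLp 2 x
    let y' : EuclideanSpace ℂ (Fin b) := ((s⁻¹ : ℝ) : ℂ) • WithLp.toLp 2 y
    have hx1 : ‖x'‖ = 1 := by
      simp only [x', norm_smul, Complex.norm_real, norm_inv, norm_norm, r]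
      exact inv_mul_cancel₀ hx'
    have hy1 : ‖y'‖ = 1 := by
      simp only [y', norm_smul, Complex.norm_real, norm_inv, norm_norm, s]
      exact inv_mul_cancel₀ hy'
    have hsc : vecMulVec x (star x) ⊗ₖ vecMulVec y (star y) = ((r ^ 2 * s ^ 2 : ℝ) : ℂ) •
        (vecMulVec x'.ofLp (star x'.ofLp) ⊗ₖ vecMulVec y'.ofLp (star y'.ofLp)) := by
      have hr : (r : ℂ) ≠ 0 := by exact_mod_cast hx'
      have hs : (s : ℂ) ≠ 0 := by exact_mod_cast hy'
      ext p q
      simp [vecMulVec_apply, x', y']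
      field_simp
    have hm := hf _ (subset_convexHull ℝ _ ⟨(x', y'), ⟨by simp [hx1], by simp [hy1]⟩, rfl⟩)
    rw [hsc, Matrix.mul_smul, Matrix.trace_smul, smul_eq_mul, Complex.re_ofReal_mul, hH,
      trace_kronecker, trace_vecMulVec_star, trace_vecMulVec_star, hx1, hy1]
    refine mul_nonneg (by positivity) ?_
    simp only [RCLike.re_eq_complex_re] at hm
    simpa using hm.le

/-- Symmetrising `H` makes its pairing with Hermitian matrices real, so signs of real parts become
inequalities in the order of `ℂ`. -/
theorem trace_add_conjTranspose_mul {n : Type*} [Fintype n] {H X : Matrix n n ℂ}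
    (hX : X.IsHermitian) : ((H + Hᴴ) * X).trace = ((2 * (H * X).trace.re : ℝ) : ℂ) := by
  have : (Hᴴ * X).trace = star (H * X).trace := by
    rw [← Matrix.trace_conjTranspose, conjTranspose_mul, hX.eq, Matrix.trace_mul_comm]
  rw [Matrix.add_mul, Matrix.trace_add, this]
  exact Complex.add_conj _

/-- Entanglement witnesses: a positive semidefinite matrix is separable if its pairing with every
block-positive matrix is non-negative. -/
theorem isSeparable_of_forall_trace {a b : ℕ} {Z : BiMat a b} (hZ : Z.PosSemidef)
    (h : ∀ H : BiMat a b, (∀ A B, A.PosSemidef → B.PosSemidef → 0 ≤ (H * (A ⊗ₖ B)).trace) →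
      0 ≤ (H * Z).trace) : IsSeparable Z := by
  by_contra hs
  obtain ⟨G, hG, hp⟩ := exists_functional_of_not_isSeparable hZ hs
  have := h (G + Gᴴ) fun A B hA hB => by
    obtain ⟨n, x, y, hxy⟩ := (isSeparable_kronecker hA hB).exists_rank_one
    rw [hxy, Matrix.mul_sum, Matrix.trace_sum]
    refine Finset.sum_nonneg fun i _ => ?_
    rw [trace_add_conjTranspose_mul ((posSemidef_vecMulVec_self_star _).kronecker
      (posSemidef_vecMulVec_self_star _)).isHermitian]
    exact_mod_cast mul_nonneg zero_le_two (hp _ _)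
  rw [trace_add_conjTranspose_mul hZ.isHermitian, Complex.zero_le_real] at this
  linarith

/-! ### Projections of prescribed rank -/

theorem exists_submodule_ge_finrank_eq {V : Type*} [AddCommGroup V] [Module ℂ V]
    [FiniteDimensional ℂ V] (S : Submodule ℂ V) {n : ℕ} (hS : Module.finrank ℂ S ≤ n)
    (hn : n ≤ Module.finrank ℂ V) : ∃ T : Submodule ℂ V, S ≤ T ∧ Module.finrank ℂ T = n := by
  induction n, hS using Nat.le_induction with
  | base => exact ⟨S, le_rfl, rfl⟩
  | succ m hm ih =>
    obtain ⟨T, hST, hT⟩ := ih (by omega)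
    obtain ⟨v, hv⟩ := T.exists_of_finrank_lt (by omega)
    have hv' : v ∉ T := by simpa using hv 1 one_ne_zero
    exact ⟨T ⊔ Submodule.span ℂ {v}, hST.trans le_sup_left, by
      rw [Submodule.finrank_sup_span_singleton hv', hT]⟩

/-- `P` projects onto a subspace of dimension `min k d` that contains `(ker V)ᗮ`, so `1 - P` maps
into `ker V`. -/
theorem exists_isStarProjection_mul_eq {m d k : ℕ} {V : Matrix (Fin m) (Fin d) ℂ}
    (hV : V.rank ≤ k) :
    ∃ P : Mat d, IsStarProjection P ∧ P.rank = min k d ∧ V * P = V := by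
  let E := EuclideanSpace ℂ (Fin d)
  let L : E →ₗ[ℂ] EuclideanSpace ℂ (Fin m) := toEuclideanLin V
  have hL : Module.finrank ℂ (LinearMap.range L) = V.rank := by
    rw [V.rank_eq_finrank_range_toLin (EuclideanSpace.basisFun _ ℂ).toBasis
      (EuclideanSpace.basisFun _ ℂ).toBasis]
    rfl
  have hdim : Module.finrank ℂ E = d := by simp [E]
  have hS : Module.finrank ℂ (LinearMap.ker L)ᗮ = V.rank := by
    have h1 := (LinearMap.ker L).finrank_add_finrank_orthogonal
    have h2 := L.finrank_range_add_finrank_ker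
    omega
  obtain ⟨T, hT, hTd⟩ := exists_submodule_ge_finrank_eq (LinearMap.ker L)ᗮ (n := min k d)
    (hS.trans_le (le_min hV (by simpa using V.rank_le_width))) (by simp [hdim])
  let P : Mat d := (toEuclideanCLM (n := Fin d) (𝕜 := ℂ)).symm T.starProjection
  have hP : toEuclideanCLM (n := Fin d) (𝕜 := ℂ) P = T.starProjection :=
    StarAlgEquiv.apply_symm_apply _ _
  refine ⟨P, ?_, ?_, ?_⟩
  · have hT' : IsStarProjection T.starProjection := isStarProjection_starProjection
    refine ⟨EquivLike.injective (toEuclideanCLM (n := Fin d) (𝕜 := ℂ)) ?_,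
      EquivLike.injective (toEuclideanCLM (n := Fin d) (𝕜 := ℂ)) ?_⟩
    · rw [map_mul, hP]
      exact hT'.isIdempotentElem
    · rw [map_star, hP]
      exact hT'.isSelfAdjoint
  · rw [P.rank_eq_finrank_range_toLin (EuclideanSpace.basisFun _ ℂ).toBasis
      (EuclideanSpace.basisFun _ ℂ).toBasis, ← hTd]
    have : LinearMap.range (toEuclideanCLM (n := Fin d) (𝕜 := ℂ) P).toLinearMap = T := by
      rw [hP]
      exact T.range_starProjection
    exact congrArg (fun S : Submodule ℂ E => Module.finrank ℂ S) this
  · apply (toEuclideanLin (𝕜 := ℂ)).injective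
    ext1 x
    have hx : x - T.starProjection x ∈ LinearMap.ker L := by
      have := T.sub_starProjection_mem_orthogonal x
      have h2 := Submodule.orthogonal_le hT this
      rwa [Submodule.orthogonal_orthogonal] at h2
    have h3 : L x = L (T.starProjection x) := by
      rw [LinearMap.mem_ker, map_sub, sub_eq_zero] at hx
      exact hx
    rw [← hP] at h3
    refine Eq.trans ?_ h3.symm
    simp [L, toEuclideanLin, toLpLin]
    rw [← Matrix.mulVec_mulVec]
    rfl

/-! ### Duality between positive maps and block-positive matrices -/

theorem apply_eq_sum_choi {a b : ℕ} (Φ : Mat a →ₗ[ℂ] Mat b) (Y : Mat a) (c d : Fin b) :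
    Φ Y c d = ∑ i, ∑ j, Y i j * choi Φ (i, c) (j, d) := by
  conv_lhs => rw [matrix_eq_sum_single Y]
  have h : ∀ i j, single i j (Y i j) = Y i j • single i j (1 : ℂ) := fun i j => by simp
  simp only [map_sum, Matrix.sum_apply, h, map_smul, Matrix.smul_apply, smul_eq_mul]
  rfl

theorem choi_comp_Ad {m a b : ℕ} (Φ : Mat a →ₗ[ℂ] Mat b) (W : Matrix (Fin m) (Fin a) ℂ) :
    choi (Φ ∘ₗ Ad W) = (Wᵀ ⊗ₖ (1 : Mat b))ᴴ * choi Φ * (Wᵀ ⊗ₖ (1 : Mat b)) := by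
  ext p q
  have : choi (Φ ∘ₗ Ad W) p q = Φ (Ad W (single p.1 q.1 1)) p.2 q.2 := rfl
  rw [this, apply_eq_sum_choi]
  simp [Ad, Matrix.mul_apply, Fintype.sum_prod_type, Matrix.one_apply, Matrix.single_apply,
    apply_ite (starRingEnd ℂ), ite_and, Finset.sum_mul]
  rw [Finset.sum_comm]
  refine Finset.sum_congr rfl fun _ _ => Finset.sum_congr rfl fun _ _ => ?_
  ring

/-- Precomposition with `Ad W` is congruence of the Choi matrix by `Wᵀ ⊗ 1`; cyclicity of the trace
moves it to the other factor, with `W` replaced by `Wᴴ`. -/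
theorem trace_choi_mul_choi_comp_Ad {a b : ℕ} (Φ Γ : Mat a →ₗ[ℂ] Mat b) (W : Mat a) :
    (choi Γ * choi (Φ ∘ₗ Ad W)).trace = (choi Φ * choi (Γ ∘ₗ Ad Wᴴ)).trace := by
  have h : (Wᴴᵀ ⊗ₖ (1 : Mat b)) = (Wᵀ ⊗ₖ (1 : Mat b))ᴴ := by
    rw [conjTranspose_kronecker, conjTranspose_one]
    rfl
  rw [choi_comp_Ad, choi_comp_Ad, h, conjTranspose_conjTranspose, ← Matrix.mul_assoc,
    Matrix.trace_mul_comm, ← Matrix.mul_assoc, ← Matrix.mul_assoc, Matrix.trace_mul_comm]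

theorem trace_mul_nonneg_of_posSemidef {n : Type*} [Fintype n] {A B : Matrix n n ℂ}
    (hA : A.PosSemidef) (hB : B.PosSemidef) : 0 ≤ (A * B).trace := by
  obtain ⟨m, v, rfl⟩ := posSemidef_iff_eq_sum_vecMulVec.mp hB
  rw [Matrix.mul_sum, Matrix.trace_sum]
  refine Finset.sum_nonneg fun i _ => ?_
  rw [mul_vecMulVec, trace_vecMulVec, dotProduct_comm]
  exact hA.dotProduct_mulVec_nonneg _

/-- The test matrices `x x*` suffice. Nonnegativity in `ℂ` includes reality, so `M` need not be
assumed Hermitian. -/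
theorem posSemidef_of_forall_trace_mul_nonneg {n : Type*} [Fintype n] {M : Matrix n n ℂ}
    (h : ∀ A : Matrix n n ℂ, A.PosSemidef → 0 ≤ (M * A).trace) : M.PosSemidef := by
  classical
  rw [← isPositive_toEuclideanLin_iff, LinearMap.isPositive_iff_complex]
  intro x
  have := h _ (posSemidef_vecMulVec_self_star x.ofLp)
  rw [mul_vecMulVec, trace_vecMulVec] at this
  have hx : inner ℂ (toEuclideanLin M x) x = M *ᵥ x.ofLp ⬝ᵥ star x.ofLp := by
    rw [← inner_conj_symm, EuclideanSpace.inner_eq_star_dotProduct]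
    exact (IsSelfAdjoint.of_nonneg this).star_eq
  rw [hx]
  exact ⟨Complex.ext rfl (Complex.nonneg_iff.mp this).2, (Complex.nonneg_iff.mp this).1⟩

/-- This is the dictionary between positive maps and block-positive matrices, since the positive
semidefinite cone is self-dual and stable under transposition. -/
theorem trace_choi_mul_kronecker {a b : ℕ} (Γ : Mat a →ₗ[ℂ] Mat b) (A : Mat a) (B : Mat b) :
    (choi Γ * (A ⊗ₖ B)).trace = (Γ Aᵀ * B).trace := by
  simp only [Matrix.trace, Matrix.diag_apply, Matrix.mul_apply, apply_eq_sum_choi Γ Aᵀ,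
    Fintype.sum_prod_type, kroneckerMap_apply, transpose_apply, Finset.sum_mul]
  rw [Finset.sum_comm]
  refine Finset.sum_congr rfl fun c _ => ?_
  rw [Finset.sum_congr rfl fun i _ => Finset.sum_comm]
  rw [Finset.sum_comm]
  refine Finset.sum_congr rfl fun d _ => Finset.sum_congr rfl fun i _ =>
    Finset.sum_congr rfl fun j _ => ?_
  ring

theorem IsPositive.trace_choi_mul_nonneg {a b : ℕ} {Γ : Mat a →ₗ[ℂ] Mat b} (hΓ : IsPositive Γ)
    {X : BiMat a b} (hX : IsSeparable X) : 0 ≤ (choi Γ * X).trace := by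
  obtain ⟨n, A, B, hA, hB, rfl⟩ := hX
  rw [Matrix.mul_sum, Matrix.trace_sum]
  refine Finset.sum_nonneg fun i _ => ?_
  rw [trace_choi_mul_kronecker]
  exact trace_mul_nonneg_of_posSemidef (hΓ _ (hA i).transpose) (hB i)

/-- Horodecki's criterion with the Choi matrices of positive maps. -/
theorem isSeparable_of_forall_isPositive {a b : ℕ} {Z : BiMat a b} (hZ : Z.PosSemidef)
    (h : ∀ Γ : Mat a →ₗ[ℂ] Mat b, IsPositive Γ → 0 ≤ (choi Γ * Z).trace) : IsSeparable Z := by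
  refine isSeparable_of_forall_trace hZ fun H hH => ?_
  obtain ⟨Γ, rfl⟩ := exists_choi_eq H
  refine h Γ fun X hX => posSemidef_of_forall_trace_mul_nonneg fun A hA => ?_
  have := hH Xᵀ A hX.transpose hA
  rwa [trace_choi_mul_kronecker, transpose_transpose] at this

/-- Horodecki's criterion for Choi matrices: a completely positive map `Θ` is entanglement breaking
if `Γ ∘ Θ` is completely positive for every positive map `Γ`. -/
theorem isEB_of_forall_isPositive_comp {a b : ℕ} {Θ : Mat a →ₗ[ℂ] Mat b}
    (hΘ : (choi Θ).PosSemidef)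
    (h : ∀ Γ : Mat b →ₗ[ℂ] Mat a, IsPositive Γ → (choi (Γ ∘ₗ Θ)).PosSemidef) : IsEB Θ := by
  refine isEB_iff.mpr (isSeparable_of_forall_trace hΘ fun H hH => ?_)
  -- The Choi matrix of `Γ` is `H`, transposed and with its tensor factors exchanged, so that `Γ`
  -- maps `M_b` back to `M_a`.
  obtain ⟨Γ, hΓ⟩ := exists_choi_eq (of fun p q => H (q.2, q.1) (p.2, p.1))
  have hent : ∀ Y j i, Γ Y j i = ∑ d, ∑ c, Y d c * H (i, c) (j, d) := by
    intro Y j i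
    rw [apply_eq_sum_choi, hΓ]
    rfl
  have hpos : IsPositive Γ := by
    refine fun Y hY => posSemidef_of_forall_trace_mul_nonneg fun A hA => ?_
    convert hH Aᵀ Y hA.transpose hY using 1
    simp only [Matrix.trace, Matrix.diag_apply, Matrix.mul_apply, hent, Fintype.sum_prod_type,
      kroneckerMap_apply, transpose_apply, Finset.sum_mul]
    rw [Finset.sum_comm]
    refine Finset.sum_congr rfl fun i _ => ?_
    conv_rhs => rw [Finset.sum_comm]
    refine Finset.sum_congr rfl fun j _ => ?_
    rw [Finset.sum_comm]
    refine Finset.sum_congr rfl fun c _ => Finset.sum_congr rfl fun d _ => ?_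
    ring
  -- The quadratic form of `choi (Γ ∘ₗ Θ)` at `∑ e_i ⊗ e_i` is the trace of `H * choi Θ`.
  have hq := (h Γ hpos).dotProduct_mulVec_nonneg (fun p => if p.1 = p.2 then 1 else 0)
  convert hq using 1
  simp [dotProduct, mulVec, Fintype.sum_prod_type, Matrix.trace, Matrix.mul_apply]
  have hc : ∀ j i, choi (Γ ∘ₗ Θ) (j, j) (i, i) =
      ∑ d, ∑ c, choi Θ (j, d) (i, c) * H (i, c) (j, d) := fun j i => hent _ j i
  simp only [hc]
  conv_rhs => rw [Finset.sum_comm]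
  refine Finset.sum_congr rfl fun i _ => ?_
  rw [Finset.sum_comm]
  refine Finset.sum_congr rfl fun j _ => ?_
  rw [Finset.sum_comm]
  exact Finset.sum_congr rfl fun d _ => Finset.sum_congr rfl fun c _ => mul_comm _ _

/-! ### Compositions of `k`-positive maps -/

/-- Write `V = A * B` through `ℂ^k`. The Choi matrix of `Φ ∘ₗ Ad B` is the image under `id_k ⊗ Φ` of
a positive semidefinite matrix, so `k`-positivity is enough. -/
theorem IsKPositive.isCP_comp_Ad {a b k m : ℕ} {Φ : Mat a →ₗ[ℂ] Mat b} (hΦ : IsKPositive k Φ)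
    {V : Matrix (Fin m) (Fin a) ℂ} (hV : V.rank ≤ k) : IsCP (Φ ∘ₗ Ad V) := by
  obtain ⟨A, B, rfl⟩ := exists_eq_mul_of_rank_le hV
  have h : IsCP (Φ ∘ₗ Ad B) :=
    isCP_of_choi_posSemidef (choi_comp Φ (Ad B) ▸ hΦ _ (isCP_Ad B).choi_posSemidef)
  rw [Ad_mul, ← LinearMap.comp_assoc]
  intro n hn X hX
  rw [idTensor_comp]
  exact h n hn _ (isCP_Ad A n hn X hX)

theorem isKPEB_Ad {a b k : ℕ} {V : Matrix (Fin a) (Fin b) ℂ} (hV : V.rank ≤ k) :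
    IsKPEB k (Ad V) :=
  ⟨isCP_Ad V, 1, fun _ => V, fun _ => hV, by simp⟩

theorem idTensor_posSemidef_of_isSeparable {m a b : ℕ} {Γ : Mat a →ₗ[ℂ] Mat b}
    (hΓ : IsPositive Γ) {X : BiMat m a} (hX : IsSeparable X) :
    (idTensor m Γ X).PosSemidef := by
  obtain ⟨n, A, B, hA, hB, rfl⟩ := hX
  rw [map_sum]
  refine posSemidef_sum _ fun i _ => ?_
  rw [idTensor_kronecker]
  exact (hA i).kronecker (hΓ _ (hB i))

theorem isEB_comp_Ad_of_forall_projection {a b k : ℕ} {Φ : Mat a →ₗ[ℂ] Mat b}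
    (h : ∀ P : Mat a, IsStarProjection P → P.rank = min k a → IsEB (Φ ∘ₗ Ad P)) {m : ℕ}
    {V : Matrix (Fin m) (Fin a) ℂ} (hV : V.rank ≤ k) : IsEB (Φ ∘ₗ Ad V) := by
  obtain ⟨P, hP, hr, hVP⟩ := exists_isStarProjection_mul_eq hV
  rw [← hVP, Ad_mul, ← LinearMap.comp_assoc]
  exact (h P hP hr).comp_Ad V

theorem isEB_of_isEmpty {b : ℕ} (Φ : Mat 0 →ₗ[ℂ] Mat b) : IsEB Φ := by
  rw [isEB_iff, Subsingleton.elim (choi Φ) 0]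
  exact .zero

end EntBreak

/-! ### The equivalences -/

theorem mainTheorem1 (d₁ d₂ k : ℕ) (hk : 1 < k)
    (Φ : EntBreak.Mat d₁ →ₗ[ℂ] EntBreak.Mat d₂) (hΦ : EntBreak.IsKPositive k Φ) :
    List.TFAE [
      EntBreak.IsKEB k Φ,
      ∀ Ψ : EntBreak.Mat k →ₗ[ℂ] EntBreak.Mat d₁, EntBreak.IsCP Ψ → EntBreak.IsEB (Φ ∘ₗ Ψ),
      ∀ m : ℕ, 1 ≤ m → m ≤ k → ∀ Ψ : EntBreak.Mat m →ₗ[ℂ] EntBreak.Mat d₁,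
        EntBreak.IsCP Ψ → EntBreak.IsEB (Φ ∘ₗ Ψ),
      ∀ Ψ : EntBreak.Mat d₁ →ₗ[ℂ] EntBreak.Mat d₁,
        EntBreak.IsKPEB k Ψ → EntBreak.IsEB (Φ ∘ₗ Ψ),
      ∀ m : ℕ, 1 ≤ m → ∀ Ψ : EntBreak.Mat m →ₗ[ℂ] EntBreak.Mat d₁,
        EntBreak.IsKPEB k Ψ → EntBreak.IsEB (Φ ∘ₗ Ψ),
      ∀ P : EntBreak.Mat d₁, IsStarProjection P → P.rank = min k d₁ →
        EntBreak.IsEB (Φ ∘ₗ EntBreak.Ad P),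
      ∀ m : ℕ, 1 ≤ m → ∀ X : EntBreak.BiMat m d₁, X.PosSemidef →
        EntBreak.schmidtNumber X ≤ k →
          (EntBreak.idTensor m Φ X).PosSemidef ∧
            EntBreak.schmidtNumber (EntBreak.idTensor m Φ X) = 1,
      ∀ X : EntBreak.BiMat d₁ d₁, X.PosSemidef →
        EntBreak.schmidtNumber X ≤ k →
          (EntBreak.idTensor d₁ Φ X).PosSemidef ∧
            EntBreak.schmidtNumber (EntBreak.idTensor d₁ Φ X) = 1,
      ∀ m : ℕ, 1 ≤ m → ∀ Γ : EntBreak.Mat d₂ →ₗ[ℂ] EntBreak.Mat m,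
        EntBreak.IsPositive Γ → EntBreak.IsKPositive k (Γ ∘ₗ Φ),
      ∀ Γ : EntBreak.Mat d₂ →ₗ[ℂ] EntBreak.Mat d₁,
        EntBreak.IsPositive Γ → EntBreak.IsKPositive k (Γ ∘ₗ Φ),
      ∀ (Ψ : EntBreak.Mat d₁ →ₗ[ℂ] EntBreak.Mat d₁) (Γ : EntBreak.Mat d₁ →ₗ[ℂ] EntBreak.Mat d₂),
        EntBreak.IsKPEB k Ψ → EntBreak.IsPositive Γ →
          0 ≤ (EntBreak.choi Φ * EntBreak.choi (Γ ∘ₗ Ψ)).trace] := by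
  open EntBreak in
  tfae_have 1 → 2 := fun h Ψ hΨ => isEB_iff.mpr (h.2 _ hΨ.choi_posSemidef)
  tfae_have 2 → 1 := by
    refine fun h => ⟨hΦ, fun X hX => ?_⟩
    obtain ⟨Ψ, rfl⟩ := exists_choi_eq X
    exact isEB_iff.mp (h Ψ (isCP_of_choi_posSemidef hX))
  tfae_have 2 → 5 := by
    rintro h m - Ψ ⟨-, n, V, hV, rfl⟩
    refine isEB_comp_sum_Ad fun i => ?_
    obtain ⟨A, B, hAB⟩ := exists_eq_mul_of_rank_le (hV i)
    rw [hAB, Ad_mul, ← LinearMap.comp_assoc]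
    exact (h _ (isCP_Ad B)).comp_Ad A
  tfae_have 5 → 3 := by
    intro h m hm hmk Ψ hΨ
    obtain ⟨n, V, hV⟩ := exists_eq_sum_Ad hΨ.choi_posSemidef
    -- Kraus operators with `m ≤ k` rows automatically have rank at most `k`.
    exact h m hm Ψ ⟨hΨ, n, V, fun i => (V i).rank_le_height.trans hmk, hV⟩
  tfae_have 3 → 2 := fun h => h k hk.le le_rfl
  tfae_have 5 → 4 := by
    intro h
    -- Specialising `m` to `d₁` needs `1 ≤ d₁`.
    rcases Nat.eq_zero_or_pos d₁ with rfl | hd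
    · exact fun Ψ _ => isEB_of_isEmpty _
    · exact h d₁ hd
  tfae_have 4 → 6 := fun h P _ hr => h _ (isKPEB_Ad (hr.trans_le (min_le_left _ _)))
  tfae_have 6 → 5 := by
    rintro h m - Ψ ⟨-, n, V, hV, rfl⟩
    exact isEB_comp_sum_Ad fun i => isEB_comp_Ad_of_forall_projection h (hV i)
  tfae_have 6 → 7 := by
    intro h m _ X hX hk'
    obtain ⟨n, V, hV, rfl⟩ := exists_sum_choi_Ad_of_schmidtNumber_le hX hk'
    have hs : IsSeparable (idTensor m Φ (∑ i, choi (Ad (V i)))) := by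
      rw [map_sum]
      exact isSeparable_sum _ fun i _ => isEB_iff.mp (isEB_comp_Ad_of_forall_projection h (hV i))
    exact ⟨hs.posSemidef, schmidtNumber_eq_one_iff.mpr hs⟩
  tfae_have 7 → 8 := by
    intro h
    rcases Nat.eq_zero_or_pos d₁ with rfl | hd
    · intro X _ _
      rw [Subsingleton.elim (idTensor 0 Φ X) 0]
      exact ⟨.zero, schmidtNumber_eq_one_iff.mpr .zero⟩
    · exact h d₁ hd
  tfae_have 8 → 6 := fun h P _ hr => isEB_iff.mpr <| schmidtNumber_eq_one_iff.mp
    (h _ (isCP_Ad P).choi_posSemidef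
      (schmidtNumber_choi_Ad_le hk.le (hr.trans_le (min_le_left _ _)))).2
  tfae_have 1 → 9 := fun h m _ Γ hΓ X hX => idTensor_posSemidef_of_isSeparable hΓ (h.2 X hX)
  tfae_have 9 → 10 := by
    intro h
    rcases Nat.eq_zero_or_pos d₁ with rfl | hd
    · intro Γ _ X _
      rw [Subsingleton.elim (idTensor k (Γ ∘ₗ Φ) X) 0]
      exact .zero
    · exact h d₁ hd
  tfae_have 10 → 6 := by
    intro h P _ hr
    have hr' : P.rank ≤ k := hr.trans_le (min_le_left _ _)
    refine isEB_of_forall_isPositive_comp (hΦ.isCP_comp_Ad hr').choi_posSemidef fun Γ hΓ => ?_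
    -- Compression by `P` turns `k`-positivity of `Γ ∘ₗ Φ` into complete positivity, as Horodecki's
    -- criterion requires.
    exact ((h Γ hΓ).isCP_comp_Ad hr').choi_posSemidef
  tfae_have 6 → 11 := by
    rintro h Ψ Γ ⟨-, n, V, hV, rfl⟩ hΓ
    have hc : choi (Γ ∘ₗ ∑ i, Ad (V i)) = ∑ i, choi (Γ ∘ₗ Ad (V i)) := by
      rw [← choi_sum]
      congr 1
      ext1 X
      simp
    rw [hc, Matrix.mul_sum, Matrix.trace_sum]
    refine Finset.sum_nonneg fun i _ => ?_
    -- Moving `Ad (V i)` from `Γ` to `Φ` under the trace replaces `V i` by its adjoint, which has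
    -- the same rank.
    have hi : (V i).conjTranspose.rank ≤ k := by
      rw [Matrix.rank_conjTranspose]
      exact hV i
    have := hΓ.trace_choi_mul_nonneg (isEB_iff.mp (isEB_comp_Ad_of_forall_projection h hi))
    rwa [trace_choi_mul_choi_comp_Ad, Matrix.conjTranspose_conjTranspose] at this
  tfae_have 11 → 6 := by
    intro h P _ hr
    have hr' : P.rank ≤ k := hr.trans_le (min_le_left _ _)
    refine isEB_iff.mpr (isSeparable_of_forall_isPositive
      (hΦ.isCP_comp_Ad hr').choi_posSemidef fun Γ hΓ => ?_)
    rw [trace_choi_mul_choi_comp_Ad]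
    refine h _ Γ (isKPEB_Ad ?_) hΓ
    rwa [Matrix.rank_conjTranspose]
  tfae_finish
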